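/- Let $\Gamma$ be a finite simple connected graph with vertex set $X$ and let $x\in X$. Assume that $\Gamma$ is pseudo-distance-regular around $x$: if $\nu$ denotes a positive eigenvector of the adjacency matrix of $\Gamma$, then for every $y\in X$ the three sums $\sum_z \nu_z/\nu_y$, taken over the neighbours $z$ of $y$ with $\partial(x,z)=\partial(x,y)-1$, $\partial(x,z)=\partial(x,y)$, and $\partial(x,z)=\partial(x,y)+1$, respectively, depend only on $\partial(x,y)$. Let $\Sigma$ be a graph isomorphic to the empty graph $S_n$ on $n\ge 2$ vertices, with vertex set $Y$, and let $H=H(\Gamma,\Sigma)$ be the graph obtained from the Cartesian product $\Gamma\,\square\,\Sigma$ by adding a new vertex $w$ adjacent to exactly the vertices $(x,y)$, $y\in Y$. For a base vertex $b$ of a finite connected graph $G$ with vertex set $Z$, let $E_i^*$ be the diagonal $Z\times Z$ matrix with $(z,z)$-entry $1$ if $\partial(b,z)=i$ and $0$ otherwise, and let the Terwilliger algebra $T(b)$ be the subalgebra of $\mathrm{Mat}_Z(\mathbb C)$ generated by the adjacency matrix of $G$ and all $E_i^*$. A $T(b)$-module is a subspace $W\subseteq\mathbb C^Z$ with $T(b)W\subseteq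 W$; it is irreducible if it is nonzero and contains no $T(b)$-modules other than $0$ and $W$; its endpoint is $\min\{i: E_i^*W\ne 0\}$; it is thin if $\dim E_i^*W\le 1$ for all $i$. Two $T(b)$-modules are isomorphic if there is a linear bijection between them that commutes with the action of every $B\in T(b)$. The shape with respect to $b$ of a walk $[y_0,y_1,\dots,y_j]$ is the word $t_1\cdots t_j$ with $t_k=r,f,\ell$ according to whether $\partial(b,y_k)-\partial(b,y_{k-1})$ equals $1,0,-1$. For vertices $y,z$ of $G$ we write $r^m(y,z)$, $r^m\ell(y,z)$, $r^mf(y,z)$, $\ell r^m(y,z)$ for the numbers of walks from $y$ to $z$ of the respective shape with respect to $b$; subscripts $\Gamma$ (base vertex $x$) and $H$ (base vertex $w$) indicate the graph. Then the following hold. (1) $H$ has, up to isomorphism, exactly one irreducible $T(w)$-module with endpoint $1$, and this module is thin. (2) Let $d$ be the eccentricity of $x$ in $\Gamma$. There exist scalars $\alpha_i,\beta_i\in\mathbb C$ $(0\le i\le d)$ such that for all $0\le i\le d$ and all $z\in X$ with $\partial(x,z)=i$, $$r^{i+1}\ell_\Gamma(x,z)=\alpha_i\, r^i_\Gamma(x,z),\qquad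 r^i f_\Gamma(x,z)=\beta_i\, r^i_\Gamma(x,z).$$ (3) For any such scalars, put $\kappa_i=\alpha_{i-1}$, $\mu_i=0$, $\theta_i=\beta_{i-1}$, $\rho_i=0$ for $1\le i\le d_H$, where $d_H$ is the eccentricity of $w$ in $H$. For a neighbour $v$ of $w$ let $D^i_j(w,v)$ be the set of vertices of $H$ at distance $i$ from $w$ and $j$ from $v$. Then for every $1\le i\le d_H$ and every neighbour $v$ of $w$: (a) for every $z\in D^i_{i+1}(w,v)\cup D^i_i(w,v)$, $\; r^i\ell_H(v,z)=\mu_i\,\ell r^i_H(v,z)$ and $r^{i-1}f_H(v,z)=\rho_i\,\ell r^i_H(v,z)$; (b) for every $z\in D^i_{i-1}(w,v)$, $\; r^i\ell_H(v,z)=\kappa_i\, r^{i-1}_H(v,z)+\mu_i\,\ell r^i_H(v,z)$ and $r^{i-1}f_H(v,z)=\theta_i\, r^{i-1}_H(v,z)+\rho_i\,\ell r^i_H(v,z)$. Moreover, $\rho_i=0$ whenever $D^i_{i+1}(w,v)\neq\emptyset$ for some neighbour $v$ of $w$. -/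

import Mathlib

namespace TerwilligerGraph

universe u v

section Graph

variable {V : Type u} (G : SimpleGraph V) (x : V)

/-- The three symbols occurring in the shape of a walk: raising, flat, lowering. -/
inductive Step : Type
  | r
  | f
  | l

/-- The symbol of one step of a walk from a vertex at distance `m` from the base vertex to a
vertex at distance `n` from it. In a connected graph adjacent vertices have distances from the
base vertex that differ by at most one, so the last case is exactly `n = m - 1`. -/
def stepSymbol (m n : ℕ) : Step :=
  if n = m + 1 then Step.r else if n = m then Step.f else Step.l

/-- The shape of a walk with respect to the base vertex `x`. -/
noncomputable def walkShape : ∀ {y z : V}, G.Walk y z → List Step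
  | _, _, SimpleGraph.Walk.nil => []
  | y, _, SimpleGraph.Walk.cons (v := t) _ p =>
      stepSymbol (G.dist x y) (G.dist x t) :: walkShape p

/-- The number of walks from `y` to `z` of shape `s` with respect to `x`. -/
noncomputable def numWalks (s : List Step) (y z : V) : ℕ :=
  Nat.card {p : G.Walk y z // walkShape G x p = s}

/-- `rPow m y z` is the number of `yz`-walks of shape `r^m` with respect to `x`. -/
noncomputable def rPow (m : ℕ) (y z : V) : ℕ :=
  numWalks G x (List.replicate m Step.r) y z

/-- `rPowL m y z` is the number of `yz`-walks of shape `r^m ℓ` with respect to `x`. -/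
noncomputable def rPowL (m : ℕ) (y z : V) : ℕ :=
  numWalks G x (List.replicate m Step.r ++ [Step.l]) y z

/-- `rPowF m y z` is the number of `yz`-walks of shape `r^m f` with respect to `x`. -/
noncomputable def rPowF (m : ℕ) (y z : V) : ℕ :=
  numWalks G x (List.replicate m Step.r ++ [Step.f]) y z

/-- `lRPow m y z` is the number of `yz`-walks of shape `ℓ r^m` with respect to `x`. -/
noncomputable def lRPow (m : ℕ) (y z : V) : ℕ :=
  numWalks G x (Step.l :: List.replicate m Step.r) y z

/-- The cell `D^i_j(x, y)`: vertices at distance `i` from `x` and `j` from `y`. -/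
def distCell (y : V) (i j : ℕ) : Set V :=
  {z | G.dist x z = i ∧ G.dist y z = j}

/-- The scalars `α i`, `β i` with `0 ≤ i ≤ ε(x)` satisfy, for every vertex `z` at distance `i`
from `x`, `r^{i+1}ℓ(x, z) = α i * r^i(x, z)` and `r^i f(x, z) = β i * r^i(x, z)`. -/
def TrivialWalkScalars (α β : ℕ → ℂ) : Prop :=
  ∀ i : ℕ, (i : ℕ∞) ≤ G.eccent x → ∀ z : V, G.dist x z = i →
    (rPowL G x (i + 1) x z : ℂ) = α i * (rPow G x i x z : ℂ) ∧
    (rPowF G x i x z : ℂ) = β i * (rPow G x i x z : ℂ)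

/-- The combinatorial conditions on walks with respect to `x`, with scalars
`κ i`, `μ i`, `θ i`, `ρ i` for `1 ≤ i ≤ ε(x)`. -/
def WalkConditions (κ μ θ ρ : ℕ → ℂ) : Prop :=
  ∀ i : ℕ, 1 ≤ i → (i : ℕ∞) ≤ G.eccent x →
    (∀ y : V, G.Adj x y →
      (∀ z ∈ distCell G x y i (i + 1) ∪ distCell G x y i i,
        (rPowL G x i y z : ℂ) = μ i * (lRPow G x i y z : ℂ) ∧
        (rPowF G x (i - 1) y z : ℂ) = ρ i * (lRPow G x i y z : ℂ)) ∧
      (∀ z ∈ distCell G x y i (i - 1),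
        (rPowL G x i y z : ℂ)
          = κ i * (rPow G x (i - 1) y z : ℂ) + μ i * (lRPow G x i y z : ℂ) ∧
        (rPowF G x (i - 1) y z : ℂ)
          = θ i * (rPow G x (i - 1) y z : ℂ) + ρ i * (lRPow G x i y z : ℂ))) ∧
    ((∃ y : V, G.Adj x y ∧ (distCell G x y i (i + 1)).Nonempty) → ρ i = 0)

open Classical in
/-- Pseudo-distance-regularity around `x` (Fiol and Garriga): the vertices are weighted by the
positive eigenvector `ν` of the adjacency matrix (in a connected graph it is unique up to
scaling, and the quotients below do not depend on the scaling), and the weighted intersection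
numbers of `y` with respect to `x` depend only on the distance from `x` to `y`. -/
def IsPseudoDistanceRegularAround [Fintype V] : Prop :=
  ∃ (ν : V → ℝ) (ev : ℝ), (∀ y, 0 < ν y) ∧ (G.adjMatrix ℝ).mulVec ν = ev • ν ∧
    ∃ c a b : ℕ → ℝ, ∀ y : V,
      (∑ z with G.Adj y z ∧ G.dist x z + 1 = G.dist x y, ν z / ν y) = c (G.dist x y) ∧
      (∑ z with G.Adj y z ∧ G.dist x z = G.dist x y, ν z / ν y) = a (G.dist x y) ∧
      (∑ z with G.Adj y z ∧ G.dist x z = G.dist x y + 1, ν z / ν y) = b (G.dist x y)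

end Graph

section Algebra

variable {V : Type u} [Fintype V] [DecidableEq V] (G : SimpleGraph V) (x : V)

open Classical in
/-- The adjacency matrix over `ℂ`. -/
noncomputable def adjMat : Matrix V V ℂ := G.adjMatrix ℂ

/-- The `i`-th dual idempotent `E_i^*` with respect to `x` (the zero matrix if `i > ε(x)`). -/
noncomputable def dualIdempotent (i : ℕ) : Matrix V V ℂ :=
  Matrix.diagonal fun y => if G.dist x y = i then 1 else 0

/-- The Terwilliger algebra `T(x)`. -/
noncomputable def terwilligerAlgebra : Subalgebra ℂ (Matrix V V ℂ) :=
  Algebra.adjoin ℂ ({adjMat G} ∪ Set.range (dualIdempotent G x))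

/-- A `T`-module: a subspace `W` of the standard module with `T W ⊆ W`. -/
def IsTModule (W : Submodule ℂ (V → ℂ)) : Prop :=
  ∀ B ∈ terwilligerAlgebra G x, ∀ w ∈ W, B.mulVec w ∈ W

/-- Irreducible `T`-modules. -/
def IsIrreducibleTModule (W : Submodule ℂ (V → ℂ)) : Prop :=
  IsTModule G x W ∧ W ≠ ⊥ ∧
    ∀ U : Submodule ℂ (V → ℂ), IsTModule G x U → U ≤ W → U = ⊥ ∨ U = W

/-- The subspace `E_i^* W`. -/
noncomputable def subconstituent (W : Submodule ℂ (V → ℂ)) (i : ℕ) : Submodule ℂ (V → ℂ) :=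
  W.map (dualIdempotent G x i).mulVecLin

/-- `W` has endpoint `r`, i.e. `r = min {i | E_i^* W ≠ 0}`. -/
def HasEndpoint (W : Submodule ℂ (V → ℂ)) (r : ℕ) : Prop :=
  IsLeast {i : ℕ | subconstituent G x W i ≠ ⊥} r

/-- `W` is thin: every `E_i^* W` has dimension at most one. -/
def IsThin (W : Submodule ℂ (V → ℂ)) : Prop :=
  ∀ i : ℕ, Module.finrank ℂ (subconstituent G x W i) ≤ 1

/-- `W` and `W'` are `T`-isomorphic: there is a linear isomorphism `σ : W → W'` with
`σ (B w) = B (σ w)` for all `B ∈ T`, `w ∈ W`. -/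
def TIsomorphic (W W' : Submodule ℂ (V → ℂ)) : Prop :=
  ∃ σ : W ≃ₗ[ℂ] W', ∀ B ∈ terwilligerAlgebra G x, ∀ w w₁ : W,
    (w₁ : V → ℂ) = B.mulVec (w : V → ℂ) → (σ w₁ : V → ℂ) = B.mulVec (σ w : V → ℂ)

end Algebra

section Construction

variable {X : Type u} {Y : Type v}

/-- The graph `H(Γ, S)`: the Cartesian product `Γ □ S` with a new vertex `w = none`, which is
joined to all vertices `(x, y)` with `y` a vertex of `S`. -/
def coneGraph (Γ : SimpleGraph X) (S : SimpleGraph Y) (x : X) :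
    SimpleGraph (Option (X × Y)) where
  Adj p q := match p, q with
    | none, none => False
    | none, some b => b.1 = x
    | some a, none => a.1 = x
    | some a, some b => (Γ □ S).Adj a b
  symm := ⟨fun p q h => by
    cases p <;> cases q
    · exact h
    · exact h
    · exact h
    · exact SimpleGraph.Adj.symm (G := Γ □ S) h⟩
  loopless := ⟨fun p h => by
    cases p
    · exact h
    · exact (Γ □ S).loopless.irrefl _ h⟩

end Construction

end TerwilligerGraph

/-
For every connected graph the `T(x)`-module generated by the indicator vector `δ_x` is irreducible:
if `u = B δ_x` is a nonzero vector of a submodule, then so is `E_0^* Bᴴ u = ⟨u, u⟩ δ_x`. For `c` in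
`ℂ^Y` of zero sum, `f ↦ f ⊗ c` sends `T(x)`-modules to `T(w)`-modules and raises the endpoint by
one, because the contributions of the copies of `x` to the entry at `w` cancel. Conversely, if a
`T(w)`-module `W` has endpoint `1`, then `E_1^* W` contains some `δ_x ⊗ c` with `c ≠ 0`, and `c` has
zero sum since `E_0^* W = 0`; so an irreducible such `W` is the image of `T(x) δ_x`.

In a pseudo-distance-regular graph the number of walks of shape `r^i` from `x` is proportional to
`ν` on each sphere around `x`, which gives the scalars `α_i` and `β_i`. They express the action of
the adjacency matrix on the vectors `r^i(x, ·)`, so these vectors span `T(x) δ_x`, with one vector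
for each sphere: `T(x) δ_x` is thin. Finally, a walk of shape `r^i`, `r^i f` or `r^i ℓ` between
vertices of copies of `Γ` never leaves its copy, and the conditions on walks in `H` reduce to the
definition of the scalars.
-/

namespace TerwilligerGraph

open scoped Matrix

section Walks

variable {V : Type*} (G : SimpleGraph V) (x : V)

lemma length_walkShape {y z : V} (p : G.Walk y z) : (walkShape G x p).length = p.length := by
  induction p with
  | nil => rfl
  | cons h p ih => rw [walkShape, List.length_cons, ih, SimpleGraph.Walk.length_cons]

lemma finite_walkShape_eq [Finite V] (s : List Step) (y z : V) :
    Finite {p : G.Walk y z // walkShape G x p = s} := by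
  classical
  have := Fintype.ofFinite V
  have hfin : {p : G.Walk y z | p.length = s.length}.Finite := Set.toFinite _
  refine (hfin.subset ?_).to_subtype
  rintro p rfl
  exact (length_walkShape G x p).symm

lemma numWalks_nil [DecidableEq V] (y z : V) :
    numWalks G x [] y z = if y = z then 1 else 0 := by
  split_ifs with h
  · subst h
    refine Nat.card_eq_one_iff_exists.2 ⟨⟨.nil, rfl⟩, ?_⟩
    rintro ⟨_ | _, hp⟩
    · rfl
    · cases hp
  · refine Nat.card_eq_zero.2 (.inl ⟨?_⟩)
    rintro ⟨_ | _, hp⟩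
    · exact h rfl
    · cases hp

open Classical in
lemma numWalks_cons [Fintype V] (t : Step) (s : List Step) (y z : V) :
    numWalks G x (t :: s) y z =
      ∑ q with G.Adj y q ∧ stepSymbol (G.dist x y) (G.dist x q) = t, numWalks G x s q z := by
  have := fun q => finite_walkShape_eq G x s q z
  let prepend : (Σ q : {q : V // G.Adj y q ∧ stepSymbol (G.dist x y) (G.dist x q) = t},
      {p : G.Walk q.1 z // walkShape G x p = s}) → {p : G.Walk y z // walkShape G x p = t :: s} :=
    fun a => ⟨.cons a.1.2.1 a.2.1, by rw [walkShape, a.1.2.2, a.2.2]⟩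
  have prepend_bijective : prepend.Bijective := by
    constructor
    · rintro ⟨⟨q, hq⟩, p, hp⟩ ⟨⟨q', hq'⟩, p', hp'⟩ h
      obtain ⟨rfl, h⟩ := SimpleGraph.Walk.cons.inj (congrArg Subtype.val h)
      obtain rfl := eq_of_heq h
      rfl
    · rintro ⟨_ | ⟨h, p⟩, hp⟩
      · cases hp
      · rw [walkShape, List.cons.injEq] at hp
        exact ⟨⟨⟨_, h, hp.1⟩, p, hp.2⟩, rfl⟩
  rw [numWalks, ← Nat.card_congr (Equiv.ofBijective prepend prepend_bijective), Nat.card_sigma]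
  exact (Finset.sum_subtype _ (by simp) fun q => numWalks G x s q z).symm

open Classical in
lemma numWalks_concat [Fintype V] (s : List Step) (t : Step) (y z : V) :
    numWalks G x (s ++ [t]) y z =
      ∑ q with G.Adj q z ∧ stepSymbol (G.dist x q) (G.dist x z) = t, numWalks G x s y q := by
  induction s generalizing y with
  | nil =>
    simp only [List.nil_append, numWalks_cons, numWalks_nil, Finset.sum_ite_eq,
      Finset.sum_ite_eq', Finset.mem_filter, Finset.mem_univ, true_and]
  | cons t' s ih =>
    simp only [List.cons_append, numWalks_cons, ih, Finset.sum_filter]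
    simp only [← Finset.sum_filter]
    exact Finset.sum_comm

lemma stepSymbol_eq_r {m n : ℕ} : stepSymbol m n = .r ↔ n = m + 1 := by
  unfold stepSymbol; split_ifs <;> simp_all

lemma stepSymbol_eq_f {m n : ℕ} : stepSymbol m n = .f ↔ n = m := by
  unfold stepSymbol; split_ifs <;> simp_all

lemma stepSymbol_eq_l {m n : ℕ} : stepSymbol m n = .l ↔ n ≠ m ∧ n ≠ m + 1 := by
  unfold stepSymbol; split_ifs <;> simp_all

lemma stepSymbol_succ_succ (m n : ℕ) : stepSymbol (m + 1) (n + 1) = stepSymbol m n := by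
  simp [stepSymbol]

variable {G}

lemma stepSymbol_dist_eq_l {y z : V} (h : G.Adj y z) :
    stepSymbol (G.dist x y) (G.dist x z) = .l ↔ G.dist x z + 1 = G.dist x y := by
  have := h.diff_dist_adj (u := x)
  rw [stepSymbol_eq_l]
  omega

open Classical in
lemma dist_add_count_walkShape {y z : V} (p : G.Walk y z) :
    G.dist x z + (walkShape G x p).count .l = G.dist x y + (walkShape G x p).count .r := by
  induction p with
  | nil => rfl
  | cons h p ih =>
    rw [walkShape, List.count_cons, List.count_cons]
    cases ht : stepSymbol (G.dist x _) (G.dist x _) with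
    | r => grind [stepSymbol_eq_r.1 ht]
    | f => grind [stepSymbol_eq_f.1 ht]
    | l => grind [(stepSymbol_dist_eq_l x h).1 ht]

variable {x}

open Classical in
lemma dist_add_count_of_numWalks_ne_zero {s : List Step} {y z : V} (h : numWalks G x s y z ≠ 0) :
    G.dist x z + s.count .l = G.dist x y + s.count .r := by
  obtain ⟨⟨p, rfl⟩⟩ := (Nat.card_ne_zero.1 h).1
  exact dist_add_count_walkShape x p

end Walks

section PseudoDistanceRegular

variable {V : Type*} [Fintype V] {G : SimpleGraph V} {x : V}

open Classical in
/-- Pseudo-distance-regularity in terms of the steps of walks: `k t i` is the weighted number of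
steps with symbol `t` that end in a given vertex at distance `i` from `x`. In the usual notation
for (weighted) intersection numbers, `k r = c`, `k f = a` and `k l = b`. -/
structure IsStepRegularWeight (G : SimpleGraph V) (x : V) (ν : V → ℝ) (k : Step → ℕ → ℝ) :
    Prop where
  ne_zero : ∀ z, ν z ≠ 0
  sum_eq : ∀ t z, ∑ q with G.Adj q z ∧ stepSymbol (G.dist x q) (G.dist x z) = t, ν q
    = k t (G.dist x z) * ν z

lemma IsPseudoDistanceRegularAround.exists_isStepRegularWeight
    (h : IsPseudoDistanceRegularAround G x) : ∃ ν k, IsStepRegularWeight G x ν k := by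
  classical
  obtain ⟨ν, -, hν, -, c, a, b, hcab⟩ := h
  refine ⟨ν, fun | .r => c | .f => a | .l => b, fun z => (hν z).ne', fun t z => ?_⟩
  rw [← div_eq_iff (hν z).ne', Finset.sum_div]
  have hstep (P : V → Prop) [DecidablePred P] (hP : ∀ q, G.Adj z q →
      (stepSymbol (G.dist x q) (G.dist x z) = t ↔ P q)) :
      ∑ q with G.Adj q z ∧ stepSymbol (G.dist x q) (G.dist x z) = t, ν q / ν z =
        ∑ q with G.Adj z q ∧ P q, ν q / ν z := by
    refine Finset.sum_congr (Finset.filter_congr fun q _ => ?_) fun _ _ => rfl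
    rw [G.adj_comm q z]
    exact and_congr_right (hP q)
  obtain ⟨hc, ha, hb⟩ := hcab z
  cases t with
  | r => exact (hstep _ fun q _ => stepSymbol_eq_r.trans eq_comm).trans hc
  | f => exact (hstep _ fun q _ => stepSymbol_eq_f.trans eq_comm).trans ha
  | l => exact (hstep _ fun q hq => (stepSymbol_dist_eq_l x hq.symm).trans eq_comm).trans hb

namespace IsStepRegularWeight

variable {ν : V → ℝ} {k : Step → ℕ → ℝ}

lemma numWalks_concat_eq (h : IsStepRegularWeight G x ν k) {s : List Step} {t : Step} {y z : V}
    (g : ℝ) (hs : ∀ q, G.Adj q z → stepSymbol (G.dist x q) (G.dist x z) = t →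
      (numWalks G x s y q : ℝ) = g * ν q) :
    (numWalks G x (s ++ [t]) y z : ℝ) = g * (k t (G.dist x z) * ν z) := by
  classical
  rw [numWalks_concat, Nat.cast_sum, ← h.sum_eq, Finset.mul_sum]
  refine Finset.sum_congr rfl fun q hq => ?_
  rw [Finset.mem_filter_univ] at hq
  exact hs q hq.1 hq.2

lemma rPow_eq (hG : G.Connected) (h : IsStepRegularWeight G x ν k) (z : V) :
    (rPow G x (G.dist x z) x z : ℝ) =
      (∏ j ∈ Finset.range (G.dist x z), k .r (j + 1)) / ν x * ν z := by
  classical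
  induction hi : G.dist x z generalizing z with
  | zero =>
    obtain rfl := hG.dist_eq_zero_iff.1 hi
    simp [rPow, numWalks_nil, h.ne_zero]
  | succ i ih =>
    rw [rPow, List.replicate_succ',
      h.numWalks_concat_eq ((∏ j ∈ Finset.range i, k .r (j + 1)) / ν x), hi,
      Finset.prod_range_succ]
    · ring
    · intro q _ ht
      exact ih q (Nat.succ.inj (hi ▸ stepSymbol_eq_r.1 ht).symm)

lemma trivialWalkScalars (hG : G.Connected) (h : IsStepRegularWeight G x ν k) :
    TrivialWalkScalars G x (fun i => (k .r (i + 1) * k .l i : ℝ)) (fun i => k .f i) := by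
  rintro _ - z rfl
  let γ := fun i => (∏ j ∈ Finset.range i, k .r (j + 1)) / ν x
  have hγ (q : V) : (rPow G x (G.dist x q) x q : ℝ) = γ (G.dist x q) * ν q := h.rPow_eq hG q
  have hl : (rPowL G x (G.dist x z + 1) x z : ℝ) =
      k .r (G.dist x z + 1) * k .l (G.dist x z) * rPow G x (G.dist x z) x z := by
    rw [rPowL, h.numWalks_concat_eq (γ (G.dist x z + 1)), hγ]
    · simp only [γ, Finset.prod_range_succ]
      ring
    · intro q hq ht
      rw [(stepSymbol_dist_eq_l x hq).1 ht]
      exact hγ q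
  have hf : (rPowF G x (G.dist x z) x z : ℝ) =
      k .f (G.dist x z) * rPow G x (G.dist x z) x z := by
    rw [rPowF, h.numWalks_concat_eq (γ (G.dist x z)), hγ]
    · ring
    · intro q _ ht
      rw [stepSymbol_eq_f.1 ht]
      exact hγ q
  dsimp only
  exact ⟨by exact_mod_cast hl, by exact_mod_cast hf⟩

end IsStepRegularWeight

lemma IsPseudoDistanceRegularAround.exists_trivialWalkScalars (hG : G.Connected)
    (h : IsPseudoDistanceRegularAround G x) : ∃ α β, TrivialWalkScalars G x α β :=
  have ⟨_, _, hν⟩ := h.exists_isStepRegularWeight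
  ⟨_, _, hν.trivialWalkScalars hG⟩

end PseudoDistanceRegular

section PrimaryModule

variable {V : Type*} [Fintype V] {G : SimpleGraph V} {x : V}

open Classical in
lemma adjMat_mulVec_apply (f : V → ℂ) (y : V) :
    (adjMat G *ᵥ f) y = ∑ z with G.Adj y z, f z := by
  rw [adjMat, SimpleGraph.adjMatrix_mulVec_apply, SimpleGraph.neighborFinset_eq_filter]

variable [DecidableEq V]

lemma dualIdempotent_mulVec_apply (i : ℕ) (f : V → ℂ) (y : V) :
    (dualIdempotent G x i *ᵥ f) y = if G.dist x y = i then f y else 0 := by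
  rw [dualIdempotent, Matrix.mulVec_diagonal, ite_mul, one_mul, zero_mul]

lemma dualIdempotent_zero_mulVec (hG : G.Connected) (f : V → ℂ) :
    dualIdempotent G x 0 *ᵥ f = f x • Pi.single x 1 := by
  ext y
  by_cases h : x = y
  · subst h
    simp [dualIdempotent_mulVec_apply]
  · simp [dualIdempotent_mulVec_apply, hG.dist_eq_zero_iff, h]

lemma adjMat_mem : adjMat G ∈ terwilligerAlgebra G x :=
  Algebra.subset_adjoin (.inl rfl)

lemma dualIdempotent_mem (i : ℕ) : dualIdempotent G x i ∈ terwilligerAlgebra G x :=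
  Algebra.subset_adjoin (.inr ⟨i, rfl⟩)

lemma conjTranspose_mem_terwilligerAlgebra {B : Matrix V V ℂ}
    (hB : B ∈ terwilligerAlgebra G x) : Bᴴ ∈ terwilligerAlgebra G x := by
  classical
  have hadj : (adjMat G).IsHermitian := G.isHermitian_adjMatrix ℂ
  have hdual (i : ℕ) : (dualIdempotent G x i).IsHermitian :=
    Matrix.isHermitian_diagonal_of_self_adjoint _ (by ext y; simp [apply_ite])
  refine (Algebra.adjoin_le (S := star (terwilligerAlgebra G x)) ?_) hB
  rintro _ (rfl | ⟨i, rfl⟩) <;>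
    rw [SetLike.mem_coe, Subalgebra.mem_star_iff, Matrix.star_eq_conjTranspose]
  · exact hadj.eq.symm ▸ adjMat_mem
  · exact (hdual i).eq.symm ▸ dualIdempotent_mem i

lemma isTModule_iff {W : Submodule ℂ (V → ℂ)} :
    IsTModule G x W ↔ (∀ f ∈ W, adjMat G *ᵥ f ∈ W) ∧
      ∀ i, ∀ f ∈ W, dualIdempotent G x i *ᵥ f ∈ W := by
  refine ⟨fun h => ⟨h _ adjMat_mem, fun i => h _ (dualIdempotent_mem i)⟩, fun ⟨hA, hE⟩ B hB => ?_⟩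
  induction hB using Algebra.adjoin_induction with
  | mem B hB =>
    rcases hB with rfl | ⟨i, rfl⟩
    exacts [hA, hE i]
  | algebraMap r =>
    intro f hf
    rw [Algebra.algebraMap_eq_smul_one, Matrix.smul_mulVec, Matrix.one_mulVec]
    exact W.smul_mem r hf
  | add B C _ _ hB hC =>
    intro f hf
    rw [Matrix.add_mulVec]
    exact W.add_mem (hB f hf) (hC f hf)
  | mul B C _ _ hB hC =>
    intro f hf
    rw [← Matrix.mulVec_mulVec]
    exact hB _ (hC f hf)

variable (G x) in
/-- The primary (or trivial) module: the `T`-module generated by the indicator vector of `x`. -/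
noncomputable def primaryModule : Submodule ℂ (V → ℂ) :=
  (Subalgebra.toSubmodule (terwilligerAlgebra G x)).map
    ((Matrix.mulVecBilin ℂ ℂ).flip (Pi.single x 1))

lemma isTModule_primaryModule : IsTModule G x (primaryModule G x) := by
  rintro B hB _ ⟨C, hC, rfl⟩
  exact ⟨B * C, (terwilligerAlgebra G x).mul_mem hB hC, (Matrix.mulVec_mulVec _ B C).symm⟩

lemma single_mem_primaryModule : Pi.single x 1 ∈ primaryModule G x :=
  ⟨1, (terwilligerAlgebra G x).one_mem, Matrix.one_mulVec _⟩

lemma IsTModule.primaryModule_le {U : Submodule ℂ (V → ℂ)} (hU : IsTModule G x U)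
    (hx : Pi.single x 1 ∈ U) : primaryModule G x ≤ U := by
  rintro _ ⟨B, hB, rfl⟩
  exact hU B hB _ hx

open scoped ComplexOrder in
lemma isIrreducibleTModule_primaryModule (hG : G.Connected) :
    IsIrreducibleTModule G x (primaryModule G x) := by
  refine ⟨isTModule_primaryModule,
    (Submodule.ne_bot_iff _).2 ⟨_, single_mem_primaryModule, by simp⟩,
    fun U hU hle => or_iff_not_imp_left.2 fun hne => hle.antisymm (hU.primaryModule_le ?_)⟩
  obtain ⟨u, hu, hu0⟩ := (Submodule.ne_bot_iff _).1 hne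
  obtain ⟨B, hB, hBu⟩ := hle hu
  -- If `u = B δ_x`, then `E_0^* Bᴴ u = ⟨u, u⟩ δ_x`.
  have hstar : (Bᴴ *ᵥ u) x = star u ⬝ᵥ u := by
    rw [← hBu]
    simp [Matrix.mulVec, dotProduct]
  have hmem := hU _ (dualIdempotent_mem 0) _ (hU _ (conjTranspose_mem_terwilligerAlgebra hB) u hu)
  rw [dualIdempotent_zero_mulVec hG, hstar] at hmem
  exact (U.smul_mem_iff (mt dotProduct_star_self_eq_zero.1 hu0)).1 hmem

lemma hasEndpoint_primaryModule (hG : G.Connected) : HasEndpoint G x (primaryModule G x) 0 := by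
  refine ⟨(Submodule.ne_bot_iff _).2 ⟨_, ⟨_, single_mem_primaryModule, rfl⟩, ?_⟩,
    fun _ _ => Nat.zero_le _⟩
  rw [Matrix.mulVecLin_apply, dualIdempotent_zero_mulVec hG]
  simp

end PrimaryModule

section ThinPrimaryModule

variable {V : Type*} {G : SimpleGraph V} {x : V}

variable (G x) in
/-- The vector counting the walks of shape `s` that start at the base vertex. -/
noncomputable def walkVec (s : List Step) : V → ℂ := fun z => numWalks G x s x z

lemma walkVec_nil [DecidableEq V] : walkVec G x [] = Pi.single x 1 := by
  ext z
  simp [walkVec, numWalks_nil, Pi.single_apply, eq_comm]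

open Classical in
lemma walkVec_apply_eq_zero {s : List Step} {z : V} (h : G.dist x z + s.count .l ≠ s.count .r) :
    walkVec G x s z = 0 := by
  by_contra h0
  have := dist_add_count_of_numWalks_ne_zero (Nat.cast_ne_zero.1 h0)
  rw [SimpleGraph.dist_self, zero_add] at this
  exact h this

lemma walkVec_replicate_r_apply_eq_zero {i : ℕ} {z : V} (h : G.dist x z ≠ i) :
    walkVec G x (List.replicate i .r) z = 0 := by
  classical
  exact walkVec_apply_eq_zero (by simpa [List.count_replicate])

lemma dist_le_eccent (hG : G.Connected) (z : V) : (G.dist x z : ℕ∞) ≤ G.eccent x :=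
  (hG.preconnected x z).coe_dist_eq_edist ▸ SimpleGraph.edist_le_eccent

namespace TrivialWalkScalars

variable {α β : ℕ → ℂ}

lemma walkVec_replicate_r_concat_f (hG : G.Connected) (h : TrivialWalkScalars G x α β) (i : ℕ) :
    walkVec G x (List.replicate i .r ++ [.f]) = β i • walkVec G x (List.replicate i .r) := by
  classical
  ext z
  by_cases hz : G.dist x z = i
  · exact (h i (hz ▸ dist_le_eccent hG z) z hz).2
  · rw [Pi.smul_apply, walkVec_replicate_r_apply_eq_zero hz, smul_zero]
    exact walkVec_apply_eq_zero (by simpa [List.count_replicate])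

lemma walkVec_replicate_r_concat_l (hG : G.Connected) (h : TrivialWalkScalars G x α β) (i : ℕ) :
    walkVec G x (List.replicate (i + 1) .r ++ [.l]) =
      α i • walkVec G x (List.replicate i .r) := by
  classical
  ext z
  by_cases hz : G.dist x z = i
  · exact (h i (hz ▸ dist_le_eccent hG z) z hz).1
  · rw [Pi.smul_apply, walkVec_replicate_r_apply_eq_zero hz, smul_zero]
    exact walkVec_apply_eq_zero (by simpa [List.count_replicate])

end TrivialWalkScalars

variable [Fintype V]

lemma adjMat_mulVec_walkVec (s : List Step) :
    adjMat G *ᵥ walkVec G x s =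
      walkVec G x (s ++ [.r]) + walkVec G x (s ++ [.f]) + walkVec G x (s ++ [.l]) := by
  classical
  ext z
  simp only [adjMat_mulVec_apply, Pi.add_apply, walkVec, numWalks_concat, Nat.cast_sum,
    Finset.sum_filter, ← Finset.sum_add_distrib]
  refine Finset.sum_congr rfl fun q _ => ?_
  cases stepSymbol (G.dist x q) (G.dist x z) <;> simp [G.adj_comm]

lemma dualIdempotent_mulVec_walkVec_replicate_r [DecidableEq V] (i j : ℕ) :
    dualIdempotent G x j *ᵥ walkVec G x (List.replicate i .r) =
      if i = j then walkVec G x (List.replicate i .r) else 0 := by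
  ext z
  rw [dualIdempotent_mulVec_apply]
  by_cases hz : G.dist x z = i
  · rw [hz]
    split_ifs <;> rfl
  · split_ifs <;> simp [walkVec_replicate_r_apply_eq_zero hz]

namespace TrivialWalkScalars

variable [DecidableEq V] {α β : ℕ → ℂ}

lemma primaryModule_le_span (hG : G.Connected) (h : TrivialWalkScalars G x α β) :
    primaryModule G x ≤
      Submodule.span ℂ (Set.range fun i => walkVec G x (List.replicate i .r)) := by
  set W := Submodule.span ℂ (Set.range fun i => walkVec G x (List.replicate i .r))
  have hmem (i : ℕ) : walkVec G x (List.replicate i .r) ∈ W := Submodule.subset_span ⟨i, rfl⟩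
  have hadj : W ≤ W.comap (adjMat G).mulVecLin := by
    refine Submodule.span_le.2 ?_
    rintro _ ⟨i, rfl⟩
    rw [SetLike.mem_coe, Submodule.mem_comap, Matrix.mulVecLin_apply, adjMat_mulVec_walkVec,
      ← List.replicate_succ', h.walkVec_replicate_r_concat_f hG]
    refine W.add_mem (W.add_mem (hmem _) (W.smul_mem _ (hmem _))) ?_
    cases i with
    | zero =>
      convert W.zero_mem
      ext z
      classical exact walkVec_apply_eq_zero (by simp)
    | succ i =>
      rw [h.walkVec_replicate_r_concat_l hG]
      exact W.smul_mem _ (hmem _)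
  have hdual (j : ℕ) : W ≤ W.comap (dualIdempotent G x j).mulVecLin := by
    refine Submodule.span_le.2 ?_
    rintro _ ⟨i, rfl⟩
    rw [SetLike.mem_coe, Submodule.mem_comap, Matrix.mulVecLin_apply,
      dualIdempotent_mulVec_walkVec_replicate_r]
    split_ifs
    exacts [hmem i, W.zero_mem]
  have hW : IsTModule G x W := isTModule_iff.2 ⟨hadj, fun j => hdual j⟩
  exact hW.primaryModule_le (walkVec_nil (G := G) (x := x) ▸ hmem 0)

lemma isThin_primaryModule (hG : G.Connected) (h : TrivialWalkScalars G x α β) :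
    IsThin G x (primaryModule G x) := by
  intro j
  have hle : subconstituent G x (primaryModule G x) j ≤
      ℂ ∙ walkVec G x (List.replicate j .r) := by
    refine (Submodule.map_mono (h.primaryModule_le_span hG)).trans ?_
    rw [Submodule.map_span_le]
    rintro _ ⟨i, rfl⟩
    rw [Matrix.mulVecLin_apply, dualIdempotent_mulVec_walkVec_replicate_r]
    split_ifs with hij
    · exact hij ▸ Submodule.mem_span_singleton_self _
    · exact Submodule.zero_mem _
  calc Module.finrank ℂ (subconstituent G x (primaryModule G x) j)
    _ ≤ Module.finrank ℂ (ℂ ∙ walkVec G x (List.replicate j .r)) := Submodule.finrank_mono hle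
    _ ≤ 1 := by
      classical exact (finrank_span_le_card _).trans (by simp)

end TrivialWalkScalars

end ThinPrimaryModule

section ConeGraph

lemma le_add_dist_of_adj {V : Type*} {G : SimpleGraph V} (hG : G.Connected) {f : V → ℕ}
    (hf : ∀ a b, G.Adj a b → f b ≤ f a + 1) (a b : V) : f b ≤ f a + G.dist a b := by
  obtain ⟨p, hp⟩ := hG.exists_walk_length_eq_dist a b
  rw [← hp]
  clear hp
  induction p with
  | nil => rfl
  | cons h p ih =>
    have := hf _ _ h
    rw [SimpleGraph.Walk.length_cons]
    omega

variable {X Y : Type*} {Γ : SimpleGraph X} {x : X}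

@[simp]
lemma coneGraph_bot_adj_some_some {a b : X} {y z : Y} :
    (coneGraph Γ (⊥ : SimpleGraph Y) x).Adj (some (a, y)) (some (b, z)) ↔ Γ.Adj a b ∧ y = z := by
  change (Γ □ ⊥).Adj (a, y) (b, z) ↔ _
  simp [SimpleGraph.boxProd_adj]

@[simp]
lemma coneGraph_adj_none_some {S : SimpleGraph Y} {b : X × Y} :
    (coneGraph Γ S x).Adj none (some b) ↔ b.1 = x := Iff.rfl

variable (Γ x) in
/-- The copy of `Γ` indexed by `y` in the cone graph. -/
def coneCopy (y : Y) : Γ →g coneGraph Γ (⊥ : SimpleGraph Y) x where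
  toFun a := some (a, y)
  map_rel' h := coneGraph_bot_adj_some_some.2 ⟨h, rfl⟩

lemma coneGraph_connected (hΓ : Γ.Connected) :
    (coneGraph Γ (⊥ : SimpleGraph Y) x).Connected := by
  have hnone (q) : (coneGraph Γ (⊥ : SimpleGraph Y) x).Reachable none q := by
    rcases q with _ | ⟨a, y⟩
    · rfl
    · have hbase : (coneGraph Γ (⊥ : SimpleGraph Y) x).Adj none (coneCopy Γ x y x) := rfl
      exact hbase.reachable.trans ((hΓ.preconnected x a).map (coneCopy Γ x y))
  exact ⟨fun p q => (hnone p).symm.trans (hnone q)⟩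

lemma coneGraph_dist_some_some_le (hΓ : Γ.Connected) (a b : X) (y : Y) :
    (coneGraph Γ (⊥ : SimpleGraph Y) x).dist (some (a, y)) (some (b, y)) ≤ Γ.dist a b := by
  obtain ⟨p, hp⟩ := hΓ.exists_walk_length_eq_dist a b
  rw [← hp, ← SimpleGraph.Walk.length_map (coneCopy Γ x y)]
  exact SimpleGraph.dist_le _

lemma coneGraph_dist_none_some (hΓ : Γ.Connected) (a : X) (y : Y) :
    (coneGraph Γ (⊥ : SimpleGraph Y) x).dist none (some (a, y)) = Γ.dist x a + 1 := by
  have hconn := coneGraph_connected (Y := Y) (x := x) hΓ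
  apply le_antisymm
  · have hbase : (coneGraph Γ (⊥ : SimpleGraph Y) x).dist none (some (x, y)) = 1 :=
      SimpleGraph.dist_eq_one_iff_adj.2 rfl
    have htriangle := hconn.dist_triangle (u := none) (v := some (x, y)) (w := some (a, y))
    have hcopy := coneGraph_dist_some_some_le (x := x) hΓ x a y
    omega
  · have hlip := le_add_dist_of_adj hconn (f := fun q => q.elim 0 fun b => Γ.dist x b.1 + 1) ?_
      none (some (a, y))
    · simpa using hlip
    rintro (_ | ⟨a, y⟩) (_ | ⟨b, z⟩) h
    · simp
    · obtain rfl : b = x := h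
      simp
    · simp
    · have := (coneGraph_bot_adj_some_some.1 h).1.diff_dist_adj (u := x)
      dsimp only [Option.elim]
      omega

lemma le_coneGraph_dist_of_ne (hΓ : Γ.Connected) (a : X) {y z : Y} (hyz : y ≠ z) :
    Γ.dist x a + 2 ≤
      (coneGraph Γ (⊥ : SimpleGraph Y) x).dist (some (x, y)) (some (a, z)) := by
  classical
  have hlip := le_add_dist_of_adj (coneGraph_connected (Y := Y) (x := x) hΓ)
    (f := fun q => q.elim 1 fun b => if b.2 = y then 0 else Γ.dist x b.1 + 2) ?_
    (some (x, y)) (some (a, z))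
  · simpa [hyz.symm] using hlip
  · rintro (_ | ⟨a, y'⟩) (_ | ⟨b, z'⟩) h
    · simp
    · obtain rfl : b = x := h
      dsimp only [Option.elim]
      split_ifs <;> simp
    · simp
    · obtain ⟨hab, rfl⟩ := coneGraph_bot_adj_some_some.1 h
      have := hab.diff_dist_adj (u := x)
      dsimp only [Option.elim]
      split_ifs <;> omega

open Classical in
lemma numWalks_coneGraph_concat [Finite X] [Finite Y] (hΓ : Γ.Connected) {s : List Step} {a : X}
    {y z : Y} (hnone : numWalks (coneGraph Γ (⊥ : SimpleGraph Y) x) none s (some (a, y)) none = 0)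
    (hs : ∀ c, numWalks (coneGraph Γ (⊥ : SimpleGraph Y) x) none s (some (a, y)) (some (c, z)) =
      if y = z then numWalks Γ x s a c else 0) (t : Step) (b : X) :
    numWalks (coneGraph Γ (⊥ : SimpleGraph Y) x) none (s ++ [t]) (some (a, y)) (some (b, z)) =
      if y = z then numWalks Γ x (s ++ [t]) a b else 0 := by
  have := Fintype.ofFinite X
  have := Fintype.ofFinite Y
  have hcopies (c : X) : ∑ z', (if (coneGraph Γ (⊥ : SimpleGraph Y) x).Adj
        (some (c, z')) (some (b, z)) ∧ stepSymbol (Γ.dist x c) (Γ.dist x b) = t then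
        numWalks (coneGraph Γ (⊥ : SimpleGraph Y) x) none s (some (a, y)) (some (c, z')) else 0) =
      if y = z then if Γ.Adj c b ∧ stepSymbol (Γ.dist x c) (Γ.dist x b) = t then
        numWalks Γ x s a c else 0 else 0 := by
    rw [Finset.sum_eq_single z (fun z' _ hz' => by simp [hz']) (by simp), hs]
    simp only [coneGraph_bot_adj_some_some, and_true]
    split_ifs <;> rfl
  simp only [numWalks_concat, Finset.sum_filter, Fintype.sum_option, hnone, ite_self, zero_add,
    Fintype.sum_prod_type, coneGraph_dist_none_some hΓ, stepSymbol_succ_succ, hcopies]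
  split_ifs <;> simp

lemma numWalks_coneGraph_replicate_r_none (hΓ : Γ.Connected) (i : ℕ) (p : X × Y) :
    numWalks (coneGraph Γ (⊥ : SimpleGraph Y) x) none (List.replicate i .r) (some p) none = 0 := by
  classical
  by_contra h
  have hcount := dist_add_count_of_numWalks_ne_zero h
  have hcount_l : (List.replicate i Step.r).count .l = 0 := by simp [List.count_replicate]
  rw [SimpleGraph.dist_self, coneGraph_dist_none_some hΓ, hcount_l] at hcount
  omega

open Classical in
lemma numWalks_coneGraph_replicate_r [Finite X] [Finite Y] (hΓ : Γ.Connected) (i : ℕ) (a b : X)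
    (y z : Y) : numWalks (coneGraph Γ (⊥ : SimpleGraph Y) x) none (List.replicate i .r)
        (some (a, y)) (some (b, z)) =
      if y = z then numWalks Γ x (List.replicate i .r) a b else 0 := by
  induction i generalizing b with
  | zero =>
    simp only [List.replicate_zero, numWalks_nil, Option.some.injEq, Prod.mk.injEq]
    split_ifs <;> simp_all
  | succ i ih =>
    rw [List.replicate_succ']
    exact numWalks_coneGraph_concat hΓ (numWalks_coneGraph_replicate_r_none hΓ i _) ih .r b

open Classical in
lemma numWalks_coneGraph_replicate_r_concat [Finite X] [Finite Y] (hΓ : Γ.Connected) (i : ℕ)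
    (t : Step) (a b : X) (y z : Y) :
    numWalks (coneGraph Γ (⊥ : SimpleGraph Y) x) none (List.replicate i .r ++ [t])
        (some (a, y)) (some (b, z)) =
      if y = z then numWalks Γ x (List.replicate i .r ++ [t]) a b else 0 :=
  numWalks_coneGraph_concat hΓ (numWalks_coneGraph_replicate_r_none hΓ i _)
    (fun c => numWalks_coneGraph_replicate_r hΓ i a c y z) t b

lemma TrivialWalkScalars.walkConditions_coneGraph [Finite X] [Finite Y] (hΓ : Γ.Connected)
    {α β : ℕ → ℂ} (h : TrivialWalkScalars Γ x α β) :
    WalkConditions (coneGraph Γ (⊥ : SimpleGraph Y) x) none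
      (fun i => α (i - 1)) (fun _ => 0) (fun i => β (i - 1)) (fun _ => 0) := by
  classical
  refine fun i hi _ => ⟨?_, fun _ => rfl⟩
  obtain ⟨i, rfl⟩ : ∃ j, i = j + 1 := ⟨i - 1, by omega⟩
  rintro (_ | ⟨a, y⟩) hv
  · exact absurd hv (SimpleGraph.irrefl _)
  obtain rfl : a = x := hv
  constructor
  · rintro (_ | ⟨b, z⟩) hz
    · simp [distCell] at hz
    have hyz : y ≠ z := by
      rintro rfl
      have := coneGraph_dist_some_some_le (x := a) hΓ a b y
      simp only [distCell, coneGraph_dist_none_some hΓ, Set.mem_union, Set.mem_ofPred_eq] at hz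
      omega
    simp [rPowL, rPowF, numWalks_coneGraph_replicate_r_concat hΓ, hyz]
  · rintro (_ | ⟨b, z⟩) ⟨hz, hz'⟩
    · simp at hz
    have hb : Γ.dist a b = i := by simpa [coneGraph_dist_none_some hΓ] using hz
    obtain rfl : y = z := by
      by_contra hyz
      have := le_coneGraph_dist_of_ne (x := a) hΓ b hyz
      omega
    simpa [rPowL, rPowF, rPow, numWalks_coneGraph_replicate_r_concat hΓ,
      numWalks_coneGraph_replicate_r hΓ] using h i (hb ▸ dist_le_eccent hΓ b) b hb

end ConeGraph

section ConeModule

variable {X Y : Type*}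

variable (X) in
/-- The map `f ↦ f ⊗ c` into the standard module of the cone graph. -/
def coneTensor (c : Y → ℂ) : (X → ℂ) →ₗ[ℂ] (Option (X × Y) → ℂ) where
  toFun f q := q.elim 0 fun b => f b.1 * c b.2
  map_add' f g := by ext (_ | q) <;> simp [add_mul]
  map_smul' a f := by ext (_ | q) <;> simp [mul_assoc]

@[simp]
lemma coneTensor_none (c : Y → ℂ) (f : X → ℂ) : coneTensor X c f none = 0 := rfl

@[simp]
lemma coneTensor_some (c : Y → ℂ) (f : X → ℂ) (a : X) (y : Y) :
    coneTensor X c f (some (a, y)) = f a * c y := rfl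

lemma coneTensor_injective {c : Y → ℂ} (hc : c ≠ 0) : Function.Injective (coneTensor X c) := by
  obtain ⟨y, hy⟩ := Function.ne_iff.1 hc
  intro f g h
  ext a
  exact mul_right_cancel₀ hy (congrFun h (some (a, y)))

lemma exists_ne_zero_sum_eq_zero [Fintype Y] [Nontrivial Y] :
    ∃ c : Y → ℂ, c ≠ 0 ∧ ∑ y, c y = 0 := by
  classical
  obtain ⟨y, z, hyz⟩ := exists_pair_ne Y
  exact ⟨Pi.single y 1 - Pi.single z 1, fun h => by simpa [hyz] using congrFun h y, by simp⟩

variable [Fintype X] [Fintype Y] {Γ : SimpleGraph X} {x : X}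

lemma adjMat_mulVec_coneTensor_none (c : Y → ℂ) (f : X → ℂ) :
    (adjMat (coneGraph Γ (⊥ : SimpleGraph Y) x) *ᵥ coneTensor X c f) none = f x * ∑ y, c y := by
  classical
  rw [adjMat_mulVec_apply, Finset.sum_filter, Fintype.sum_option, Fintype.sum_prod_type,
    Finset.sum_eq_single x]
  · simp [Finset.mul_sum]
  · intro b _ hb
    simp [hb]
  · simp

lemma adjMat_mulVec_coneTensor {c : Y → ℂ} (hc : ∑ y, c y = 0) (f : X → ℂ) :
    adjMat (coneGraph Γ (⊥ : SimpleGraph Y) x) *ᵥ coneTensor X c f =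
      coneTensor X c (adjMat Γ *ᵥ f) := by
  classical
  ext (_ | ⟨a, y⟩)
  · rw [adjMat_mulVec_coneTensor_none, hc, mul_zero, coneTensor_none]
  · rw [adjMat_mulVec_apply, Finset.sum_filter, Fintype.sum_option, Fintype.sum_prod_type,
      coneTensor_some, adjMat_mulVec_apply, Finset.sum_filter, Finset.sum_mul]
    simp [ite_and]

variable [DecidableEq X] [DecidableEq Y]

lemma dualIdempotent_zero_mulVec_coneTensor (hΓ : Γ.Connected) (c : Y → ℂ) (f : X → ℂ) :
    dualIdempotent (coneGraph Γ (⊥ : SimpleGraph Y) x) none 0 *ᵥ coneTensor X c f = 0 := by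
  ext (_ | ⟨a, y⟩) <;> simp [dualIdempotent_mulVec_apply, coneGraph_dist_none_some hΓ]

lemma dualIdempotent_succ_mulVec_coneTensor (hΓ : Γ.Connected) (c : Y → ℂ) (f : X → ℂ) (i : ℕ) :
    dualIdempotent (coneGraph Γ (⊥ : SimpleGraph Y) x) none (i + 1) *ᵥ coneTensor X c f =
      coneTensor X c (dualIdempotent Γ x i *ᵥ f) := by
  ext (_ | ⟨a, y⟩) <;> simp [dualIdempotent_mulVec_apply, coneGraph_dist_none_some hΓ]

lemma dualIdempotent_one_mulVec (hΓ : Γ.Connected) (f : Option (X × Y) → ℂ) :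
    dualIdempotent (coneGraph Γ (⊥ : SimpleGraph Y) x) none 1 *ᵥ f =
      coneTensor X (fun y => f (some (x, y))) (Pi.single x 1) := by
  ext (_ | ⟨a, y⟩)
  · simp [dualIdempotent_mulVec_apply]
  · by_cases ha : x = a
    · subst ha
      simp [dualIdempotent_mulVec_apply, coneGraph_dist_none_some hΓ]
    · simp [dualIdempotent_mulVec_apply, coneGraph_dist_none_some hΓ, hΓ.dist_eq_zero_iff, ha]

lemma IsTModule.comap_coneTensor (hΓ : Γ.Connected) {c : Y → ℂ} (hc : ∑ y, c y = 0)
    {U : Submodule ℂ (Option (X × Y) → ℂ)}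
    (hU : IsTModule (coneGraph Γ (⊥ : SimpleGraph Y) x) none U) :
    IsTModule Γ x (U.comap (coneTensor X c)) := by
  refine isTModule_iff.2 ⟨fun f hf => ?_, fun i f hf => ?_⟩
  · rw [Submodule.mem_comap, ← adjMat_mulVec_coneTensor (x := x) hc]
    exact hU _ adjMat_mem _ hf
  · rw [Submodule.mem_comap, ← dualIdempotent_succ_mulVec_coneTensor hΓ]
    exact hU _ (dualIdempotent_mem _) _ hf

lemma IsTModule.map_coneTensor (hΓ : Γ.Connected) {c : Y → ℂ} (hc : ∑ y, c y = 0)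
    {P : Submodule ℂ (X → ℂ)} (hP : IsTModule Γ x P) :
    IsTModule (coneGraph Γ (⊥ : SimpleGraph Y) x) none (P.map (coneTensor X c)) := by
  refine isTModule_iff.2 ⟨?_, ?_⟩
  · rintro _ ⟨f, hf, rfl⟩
    rw [adjMat_mulVec_coneTensor hc]
    exact Submodule.mem_map_of_mem (hP _ adjMat_mem _ hf)
  · rintro (_ | i) _ ⟨f, hf, rfl⟩
    · rw [dualIdempotent_zero_mulVec_coneTensor hΓ]
      exact Submodule.zero_mem _
    · rw [dualIdempotent_succ_mulVec_coneTensor hΓ]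
      exact Submodule.mem_map_of_mem (hP _ (dualIdempotent_mem i) _ hf)

lemma IsIrreducibleTModule.map_coneTensor (hΓ : Γ.Connected) {c : Y → ℂ} (hc : ∑ y, c y = 0)
    (hc0 : c ≠ 0) {P : Submodule ℂ (X → ℂ)} (hP : IsIrreducibleTModule Γ x P) :
    IsIrreducibleTModule (coneGraph Γ (⊥ : SimpleGraph Y) x) none (P.map (coneTensor X c)) := by
  have hinj := coneTensor_injective (X := X) hc0
  refine ⟨hP.1.map_coneTensor hΓ hc, ?_, fun U hU hle => ?_⟩
  · exact (Submodule.map_injective_of_injective hinj).ne_iff' (Submodule.map_bot _) |>.2 hP.2.1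
  · have hU_eq : (U.comap (coneTensor X c)).map (coneTensor X c) = U :=
      Submodule.map_comap_eq_of_le (hle.trans LinearMap.map_le_range)
    have hcomap_le : U.comap (coneTensor X c) ≤ P := by
      rw [← Submodule.comap_map_eq_of_injective hinj P]
      exact Submodule.comap_mono hle
    rw [← hU_eq]
    refine (hP.2.2 _ (hU.comap_coneTensor hΓ hc) hcomap_le).imp (fun h => ?_) (fun h => ?_)
    · rw [h, Submodule.map_bot]
    · rw [h]

-- One operator `L` serves every `c`, so that different choices of `c` give isomorphic modules.
lemma exists_mulVec_coneTensor (hΓ : Γ.Connected)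
    {B : Matrix (Option (X × Y)) (Option (X × Y)) ℂ}
    (hB : B ∈ terwilligerAlgebra (coneGraph Γ (⊥ : SimpleGraph Y) x) none) :
    ∃ L : Matrix X X ℂ, ∀ c : Y → ℂ, ∑ y, c y = 0 → ∀ f,
      B *ᵥ coneTensor X c f = coneTensor X c (L *ᵥ f) := by
  induction hB using Algebra.adjoin_induction with
  | mem B hB =>
    rcases hB with rfl | ⟨_ | i, rfl⟩
    · exact ⟨adjMat Γ, fun c hc => adjMat_mulVec_coneTensor hc⟩
    · exact ⟨0, fun c _ f => by
        rw [dualIdempotent_zero_mulVec_coneTensor hΓ, Matrix.zero_mulVec, map_zero]⟩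
    · exact ⟨dualIdempotent Γ x i, fun c _ f => dualIdempotent_succ_mulVec_coneTensor hΓ c f i⟩
  | algebraMap r =>
    exact ⟨r • 1, fun c _ f => by
      simp only [Algebra.algebraMap_eq_smul_one, Matrix.smul_mulVec, Matrix.one_mulVec, map_smul]⟩
  | add B C _ _ hB hC =>
    obtain ⟨L, hL⟩ := hB
    obtain ⟨M, hM⟩ := hC
    exact ⟨L + M, fun c hc f => by
      rw [Matrix.add_mulVec, Matrix.add_mulVec, map_add, hL c hc, hM c hc]⟩
  | mul B C _ _ hB hC =>
    obtain ⟨L, hL⟩ := hB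
    obtain ⟨M, hM⟩ := hC
    exact ⟨L * M, fun c hc f => by
      rw [← Matrix.mulVec_mulVec, ← Matrix.mulVec_mulVec, hM c hc, hL c hc]⟩

lemma tIsomorphic_map_coneTensor (hΓ : Γ.Connected) {c c' : Y → ℂ} (hc : ∑ y, c y = 0)
    (hc0 : c ≠ 0) (hc' : ∑ y, c' y = 0) (hc0' : c' ≠ 0) (P : Submodule ℂ (X → ℂ)) :
    TIsomorphic (coneGraph Γ (⊥ : SimpleGraph Y) x) none
      (P.map (coneTensor X c)) (P.map (coneTensor X c')) := by
  let e := P.equivMapOfInjective _ (coneTensor_injective hc0)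
  let e' := P.equivMapOfInjective _ (coneTensor_injective hc0')
  refine ⟨e.symm.trans e', fun B hB w w₁ hw => ?_⟩
  obtain ⟨L, hL⟩ := exists_mulVec_coneTensor hΓ hB
  obtain ⟨f, rfl⟩ := e.surjective w
  obtain ⟨g, rfl⟩ := e.surjective w₁
  simp only [LinearEquiv.trans_apply, LinearEquiv.symm_apply_apply, e, e',
    Submodule.coe_equivMapOfInjective_apply] at hw ⊢
  rw [hL c hc] at hw
  rw [hL c' hc', coneTensor_injective hc0 hw]

lemma subconstituent_zero_map_coneTensor (hΓ : Γ.Connected) (c : Y → ℂ)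
    (P : Submodule ℂ (X → ℂ)) :
    subconstituent (coneGraph Γ (⊥ : SimpleGraph Y) x) none (P.map (coneTensor X c)) 0 = ⊥ := by
  rw [eq_bot_iff]
  rintro _ ⟨_, ⟨f, -, rfl⟩, rfl⟩
  exact dualIdempotent_zero_mulVec_coneTensor hΓ c f

lemma subconstituent_succ_map_coneTensor (hΓ : Γ.Connected) (c : Y → ℂ)
    (P : Submodule ℂ (X → ℂ)) (i : ℕ) :
    subconstituent (coneGraph Γ (⊥ : SimpleGraph Y) x) none (P.map (coneTensor X c)) (i + 1) =
      (subconstituent Γ x P i).map (coneTensor X c) := by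
  rw [subconstituent, subconstituent, ← Submodule.map_comp, ← Submodule.map_comp]
  congr 1
  exact LinearMap.ext fun f => dualIdempotent_succ_mulVec_coneTensor hΓ c f i

lemma HasEndpoint.map_coneTensor (hΓ : Γ.Connected) {c : Y → ℂ} (hc0 : c ≠ 0)
    {P : Submodule ℂ (X → ℂ)} {r : ℕ} (hP : HasEndpoint Γ x P r) :
    HasEndpoint (coneGraph Γ (⊥ : SimpleGraph Y) x) none (P.map (coneTensor X c)) (r + 1) := by
  have hsucc (i : ℕ) : subconstituent (coneGraph Γ (⊥ : SimpleGraph Y) x) none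
      (P.map (coneTensor X c)) (i + 1) ≠ ⊥ ↔ subconstituent Γ x P i ≠ ⊥ := by
    rw [subconstituent_succ_map_coneTensor hΓ]
    exact (Submodule.map_injective_of_injective (coneTensor_injective hc0)).ne_iff'
      (Submodule.map_bot _)
  refine ⟨(hsucc r).2 hP.1, ?_⟩
  rintro (_ | i) hi
  · exact absurd (subconstituent_zero_map_coneTensor hΓ c P) hi
  · exact Nat.succ_le_succ (hP.2 ((hsucc i).1 hi))

lemma IsThin.map_coneTensor (hΓ : Γ.Connected) {P : Submodule ℂ (X → ℂ)} (hP : IsThin Γ x P)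
    (c : Y → ℂ) :
    IsThin (coneGraph Γ (⊥ : SimpleGraph Y) x) none (P.map (coneTensor X c)) := by
  rintro (_ | i)
  · rw [subconstituent_zero_map_coneTensor hΓ, finrank_bot]
    exact zero_le_one
  · rw [subconstituent_succ_map_coneTensor hΓ]
    exact (Submodule.finrank_map_le _ _).trans (hP i)

lemma exists_coneTensor_single_mem (hΓ : Γ.Connected) {W : Submodule ℂ (Option (X × Y) → ℂ)}
    (hW : IsTModule (coneGraph Γ (⊥ : SimpleGraph Y) x) none W)
    (hend : HasEndpoint (coneGraph Γ (⊥ : SimpleGraph Y) x) none W 1) :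
    ∃ c : Y → ℂ, c ≠ 0 ∧ ∑ y, c y = 0 ∧ coneTensor X c (Pi.single x 1) ∈ W := by
  obtain ⟨u, ⟨f, hf, rfl⟩, hu0⟩ := (Submodule.ne_bot_iff _).1 hend.1
  set c : Y → ℂ := fun y => f (some (x, y))
  have hEf : dualIdempotent (coneGraph Γ (⊥ : SimpleGraph Y) x) none 1 *ᵥ f =
      coneTensor X c (Pi.single x 1) := dualIdempotent_one_mulVec hΓ f
  have hmem := hW _ (dualIdempotent_mem 1) f hf
  rw [Matrix.mulVecLin_apply, hEf] at hu0
  rw [hEf] at hmem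
  refine ⟨c, fun hc => hu0 ?_, ?_, hmem⟩
  · ext (_ | ⟨a, y⟩) <;> simp [hc]
  · have hbot : subconstituent (coneGraph Γ (⊥ : SimpleGraph Y) x) none W 0 = ⊥ :=
      not_not.1 fun h => absurd (hend.2 h) (by decide)
    have hzero := LinearMap.le_ker_iff_map.2 hbot (hW _ adjMat_mem _ hmem)
    have := congrFun hzero none
    simpa [dualIdempotent_mulVec_apply, adjMat_mulVec_coneTensor_none] using this

lemma exists_map_coneTensor_primaryModule_eq (hΓ : Γ.Connected)
    {W : Submodule ℂ (Option (X × Y) → ℂ)}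
    (hW : IsIrreducibleTModule (coneGraph Γ (⊥ : SimpleGraph Y) x) none W)
    (hend : HasEndpoint (coneGraph Γ (⊥ : SimpleGraph Y) x) none W 1) :
    ∃ c : Y → ℂ, c ≠ 0 ∧ ∑ y, c y = 0 ∧ (primaryModule Γ x).map (coneTensor X c) = W := by
  obtain ⟨c, hc0, hc, hmem⟩ := exists_coneTensor_single_mem hΓ hW.1 hend
  have hle : (primaryModule Γ x).map (coneTensor X c) ≤ W :=
    Submodule.map_le_iff_le_comap.2 ((hW.1.comap_coneTensor hΓ hc).primaryModule_le hmem)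
  have hirr := (isIrreducibleTModule_primaryModule (x := x) hΓ).map_coneTensor hΓ hc hc0
  exact ⟨c, hc0, hc, (hW.2.2 _ hirr.1 hle).resolve_left hirr.2.1⟩

end ConeModule

end TerwilligerGraph

open TerwilligerGraph in
theorem proposition7p3_general {X Y : Type*} [Fintype X] [DecidableEq X] [Fintype Y]
    [DecidableEq Y] [Nontrivial Y] (Γ : SimpleGraph X) (x : X) (hΓ : Γ.Connected) :
    (∃ W : Submodule ℂ (Option (X × Y) → ℂ),
      (IsIrreducibleTModule (coneGraph Γ (⊥ : SimpleGraph Y) x) none W ∧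
        HasEndpoint (coneGraph Γ (⊥ : SimpleGraph Y) x) none W 1) ∧
      ((∃ α β, TrivialWalkScalars Γ x α β) →
        IsThin (coneGraph Γ (⊥ : SimpleGraph Y) x) none W) ∧
      ∀ W' : Submodule ℂ (Option (X × Y) → ℂ),
        IsIrreducibleTModule (coneGraph Γ (⊥ : SimpleGraph Y) x) none W' →
        HasEndpoint (coneGraph Γ (⊥ : SimpleGraph Y) x) none W' 1 →
        TIsomorphic (coneGraph Γ (⊥ : SimpleGraph Y) x) none W W') ∧
    (∀ α β : ℕ → ℂ, TrivialWalkScalars Γ x α β →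
      WalkConditions (coneGraph Γ (⊥ : SimpleGraph Y) x) none
        (fun i => α (i - 1)) (fun _ => 0) (fun i => β (i - 1)) (fun _ => 0)) := by
  obtain ⟨c, hc0, hc⟩ := exists_ne_zero_sum_eq_zero (Y := Y)
  refine ⟨⟨(primaryModule Γ x).map (coneTensor X c),
    ⟨(isIrreducibleTModule_primaryModule hΓ).map_coneTensor hΓ hc hc0,
      (hasEndpoint_primaryModule hΓ).map_coneTensor hΓ hc0⟩,
    fun ⟨_, _, h⟩ => (h.isThin_primaryModule hΓ).map_coneTensor hΓ c, fun W' hW' hend => ?_⟩,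
    fun _ _ h => h.walkConditions_coneGraph hΓ⟩
  obtain ⟨c', hc0', hc', rfl⟩ := exists_map_coneTensor_primaryModule_eq hΓ hW' hend
  exact tIsomorphic_map_coneTensor hΓ hc hc0 hc' hc0' _

open TerwilligerGraph in
theorem proposition7p3 {X : Type*} {Y : Type*} [Fintype X] [DecidableEq X]
    [Fintype Y] [DecidableEq Y] (Γ : SimpleGraph X) (S : SimpleGraph Y) (x : X)
    (hconn : Γ.Connected) (hpdr : IsPseudoDistanceRegularAround Γ x)
    (n : ℕ) (hn : 2 ≤ n) (hS : Nonempty (S ≃g (⊥ : SimpleGraph (Fin n)))) :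
    (∃ W : Submodule ℂ (Option (X × Y) → ℂ),
      (IsIrreducibleTModule (coneGraph Γ S x) none W ∧
        HasEndpoint (coneGraph Γ S x) none W 1) ∧
      IsThin (coneGraph Γ S x) none W ∧
      ∀ W' : Submodule ℂ (Option (X × Y) → ℂ),
        IsIrreducibleTModule (coneGraph Γ S x) none W' →
        HasEndpoint (coneGraph Γ S x) none W' 1 →
        TIsomorphic (coneGraph Γ S x) none W W') ∧
    (∃ α β : ℕ → ℂ, TrivialWalkScalars Γ x α β) ∧
    (∀ α β : ℕ → ℂ, TrivialWalkScalars Γ x α β →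
      WalkConditions (coneGraph Γ S x) none
        (fun i => α (i - 1)) (fun _ => 0) (fun i => β (i - 1)) (fun _ => 0)) := by
  obtain ⟨e⟩ := hS
  obtain rfl : S = ⊥ := eq_bot_iff.2 fun _ _ h => e.map_adj_iff.2 h
  have : Nontrivial (Fin n) := Fin.nontrivial_iff_two_le.2 hn
  have : Nontrivial Y := e.toEquiv.nontrivial
  have hscalars := hpdr.exists_trivialWalkScalars hconn
  obtain ⟨⟨W, hW, hthin, huniq⟩, hwalks⟩ := proposition7p3_general (Y := Y) Γ x hconn
  exact ⟨⟨W, hW, hthin hscalars, huniq⟩, hscalars, hwalks⟩
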